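/- Let $n\ge 2$ be an integer and let $\zeta$ be a real number that is not algebraic of degree $\le n$. For $Q>1$ let $$K(Q)=\{(z_1,\dots,z_{n+1})\in\mathbb{R}^{n+1}: |z_1|\le Q,\ |z_i|\le Q^{-1/n}\ (2\le i\le n+1)\},$$ let $K^{\ast}(Q)=\{\boldsymbol{x}\in\mathbb{R}^{n+1}:\langle \boldsymbol{x},\boldsymbol{z}\rangle\le 1 \text{ for all } \boldsymbol{z}\in K(Q)\}$ be the dual convex body, and let $$\Lambda^{\ast}=\{(x+\zeta y_1+\zeta^2y_2+\cdots+\zeta^n y_n,\,y_1,\dots,y_n): x,y_1,\dots,y_n\in\mathbb{Z}\}.$$ For $1\le j\le n+1$ let $\lambda^{\ast}_{n,j}(Q)$ be the $j$-th successive minimum of $K^{\ast}(Q)$ with respect to $\Lambda^{\ast}$, that is, the smallest $\lambda>0$ such that $\lambda K^{\ast}(Q)$ contains at least $j$ linearly independent points of $\Lambda^{\ast}$, and define $\psi^{\ast}_{n,j}(Q)$ by $Q^{\psi^{\ast}_{n,j}(Q)}=\lambda^{\ast}_{n,j}(Q)$. Then each function $\psi^{\ast}_{n,j}$, $1\le j\le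 n+1$, is bounded for all sufficiently large $Q$, so that $\underline{\psi}^{\ast}_{n,j}:=\liminf_{Q\to\infty}\psi^{\ast}_{n,j}(Q)$ is a real number, and $$\underline{\psi}^{\ast}_{n,1}\le -\frac{2}{n-1}\,\underline{\psi}^{\ast}_{n,n+1}.$$ -/

import Mathlib

open Filter
open scoped Pointwise

noncomputable section

/-- The `j`-th successive minimum of `K` with respect to `L`: the least `l > 0` such that `l • K`
contains at least `j` linearly independent points of `L`. -/
def successiveMinimum {m : ℕ} (K L : Set (Fin m → ℝ)) (j : ℕ) : ℝ :=
  sInf {l : ℝ | 0 < l ∧ ∃ v : Fin j → (Fin m → ℝ),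
    LinearIndependent ℝ v ∧ ∀ i, v i ∈ L ∧ v i ∈ l • K}

/-- The parallelepiped `K(Q)`: points `(z₁, …, z_{n+1})` with `|z₁| ≤ Q` and
`|z_i| ≤ Q^(-1/n)` for `2 ≤ i ≤ n + 1`. -/
def parallelepipedK (n : ℕ) (Q : ℝ) : Set (Fin (n + 1) → ℝ) :=
  {z | |z 0| ≤ Q ∧ ∀ i : Fin n, |z i.succ| ≤ Q ^ (-(1 / (n : ℝ)))}

/-- The dual (polar) body `{x : ⟨x, z⟩ ≤ 1 for all z ∈ K}`. -/
def dualBody {m : ℕ} (K : Set (Fin m → ℝ)) : Set (Fin m → ℝ) :=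
  {x | ∀ z ∈ K, dotProduct x z ≤ 1}

/-- The lattice `Λ*` of all points `(x + ζ y₁ + ζ² y₂ + ⋯ + ζⁿ yₙ, y₁, …, yₙ)`
with integers `x, y₁, …, yₙ`. -/
def dualLattice (n : ℕ) (ζ : ℝ) : Set (Fin (n + 1) → ℝ) :=
  {v | ∃ (x : ℤ) (y : Fin n → ℤ),
    v 0 = (x : ℝ) + ∑ i : Fin n, ζ ^ ((i : ℕ) + 1) * (y i : ℝ) ∧
    ∀ i : Fin n, v i.succ = (y i : ℝ)}

/-- `λ*_{n,j}(Q)`: the `j`-th successive minimum of `K*(Q)` with respect to `Λ*`. -/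
def dualLambda (n : ℕ) (ζ : ℝ) (j : ℕ) (Q : ℝ) : ℝ :=
  successiveMinimum (dualBody (parallelepipedK n Q)) (dualLattice n ζ) j

/-- `ψ*_{n,j}(Q)`, determined for `Q > 1` by `Q ^ ψ*_{n,j}(Q) = λ*_{n,j}(Q)`. -/
def dualPsi (n : ℕ) (ζ : ℝ) (j : ℕ) (Q : ℝ) : ℝ :=
  Real.logb Q (dualLambda n ζ j Q)

end

/-!
A point of `Λ*` is an integer polynomial `P` of degree at most `n`, written in the coordinates
`(P(ζ), y₁, …, yₙ)`, and it lies in `B • K*(Q)` exactly when its weighted `ℓ¹`-norm `qNorm n Q` is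
at most `B`. The argument stays on the dual side throughout.

Let `0 < a < liminf ψ*_{n,n+1}`. For all large `Q` the lattice points of `Q^a • K*(Q)` then do not
span the space. A change of the subspace which they span forces a loss of a second dimension:
for arbitrarily large `Q` the lattice points of `C⁻¹ Q^a • K*(Q)`, with a fixed constant `C`, span
a subspace of dimension at most `n - 1` (`exists_finrank_span_smallPoints_le`). Otherwise the span
would be a hyperplane for all large `Q`, and comparing `Q` with `2 Q` shows that this hyperplane
would be constant. This is impossible: the hyperplane is not `{v | v 0 = 0}`, because `P(ζ) ≠ 0`
for every nonzero `P` (here the hypothesis on `ζ` enters), so a fixed lattice point off it can be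
moved close to the origin by a vector of the hyperplane, as `Q` grows, and that vector can be
rounded to a lattice point.

For such `Q` put `B = Q^a / C`. By the pigeonhole principle `B • K*(Q)` contains a constant times
`B^(n+1)` lattice points (`exists_many_smallPoints`). They lie in a space of dimension at most
`n - 1`, so a volume packing argument (`card_le_pow_finrank_of_separated`) gives two of them at
distance at most a constant times `B^(-2/(n-1))`. Their difference bounds the first minimum
(`dualLambda_one_le_rpow`), which gives `liminf ψ*_{n,1} ≤ -2a/(n-1)`. If
`liminf ψ*_{n,n+1} ≤ 0`, it is enough that the first minimum is bounded
(`dualLambda_one_le_const`).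
-/

/-! ### The gauge of the dual body -/

/-- The gauge of the dual body `K*(Q)`: a weighted `ℓ¹`-norm. -/
noncomputable def qNorm (n : ℕ) (Q : ℝ) (v : Fin (n + 1) → ℝ) : ℝ :=
  Q * |v 0| + Q ^ (-(1 / (n : ℝ))) * ∑ i : Fin n, |v i.succ|

/-- The lattice points of `B • K*(Q)`. -/
def smallPoints (n : ℕ) (ζ Q B : ℝ) : Set (Fin (n + 1) → ℝ) :=
  {v | v ∈ dualLattice n ζ ∧ qNorm n Q v ≤ B}

theorem qNorm_add_le (n : ℕ) {Q : ℝ} (hQ : 0 < Q) (v w : Fin (n + 1) → ℝ) :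
    qNorm n Q (v + w) ≤ qNorm n Q v + qNorm n Q w := by
  have hq : 0 < Q ^ (-(1 / (n : ℝ))) := Real.rpow_pos_of_pos hQ _
  have h1 : Q * |(v + w) 0| ≤ Q * (|v 0| + |w 0|) :=
    mul_le_mul_of_nonneg_left (abs_add_le _ _) hQ.le
  have h2 : Q ^ (-(1 / (n : ℝ))) * ∑ i : Fin n, |(v + w) i.succ| ≤
      Q ^ (-(1 / (n : ℝ))) * ∑ i : Fin n, (|v i.succ| + |w i.succ|) :=
    mul_le_mul_of_nonneg_left (Finset.sum_le_sum fun i _ => abs_add_le _ _) hq.le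
  rw [Finset.sum_add_distrib] at h2
  unfold qNorm
  linarith

theorem qNorm_smul (n : ℕ) (Q c : ℝ) (v : Fin (n + 1) → ℝ) :
    qNorm n Q (c • v) = |c| * qNorm n Q v := by
  simp only [qNorm, Pi.smul_apply, smul_eq_mul, abs_mul, ← Finset.mul_sum]
  ring

theorem qNorm_zero (n : ℕ) (Q : ℝ) : qNorm n Q 0 = 0 := by
  simp [qNorm]

theorem qNorm_nonneg (n : ℕ) {Q : ℝ} (hQ : 0 < Q) (v : Fin (n + 1) → ℝ) : 0 ≤ qNorm n Q v := by
  have hq : 0 < Q ^ (-(1 / (n : ℝ))) := Real.rpow_pos_of_pos hQ _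
  unfold qNorm
  positivity

theorem qNorm_sum_le {ι : Type*} (n : ℕ) {Q : ℝ} (hQ : 0 < Q) (s : Finset ι)
    (f : ι → Fin (n + 1) → ℝ) : qNorm n Q (∑ i ∈ s, f i) ≤ ∑ i ∈ s, qNorm n Q (f i) :=
  Finset.le_sum_of_subadditive _ (qNorm_zero n Q).le (qNorm_add_le n hQ) s f

theorem mem_dualBody_parallelepipedK_iff (n : ℕ) {Q : ℝ} (hQ : 0 < Q) (v : Fin (n + 1) → ℝ) :
    v ∈ dualBody (parallelepipedK n Q) ↔ qNorm n Q v ≤ 1 := by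
  have hq : 0 < Q ^ (-(1 / (n : ℝ))) := Real.rpow_pos_of_pos hQ _
  have habs : ∀ x : ℝ, |(SignType.sign x : ℝ)| ≤ 1 := fun x => by
    rcases lt_trichotomy x 0 with h | h | h <;> simp [h]
  constructor
  · intro h
    -- the pairing with the vertex of `K(Q)` whose signs match those of `v` is the gauge of `v`
    have := h (Fin.cons (Q * SignType.sign (v 0))
      fun i : Fin n => Q ^ (-(1 / (n : ℝ))) * SignType.sign (v i.succ)) (by
        constructor
        · simpa [abs_mul, abs_of_pos hQ] using mul_le_mul_of_nonneg_left (habs (v 0)) hQ.le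
        · intro i
          rw [Fin.cons_succ, abs_mul, abs_of_pos hq]
          exact mul_le_of_le_one_right hq.le (habs (v i.succ)))
    rw [dotProduct, Fin.sum_univ_succ] at this
    simp only [Fin.cons_zero, Fin.cons_succ] at this
    refine le_trans (le_of_eq ?_) this
    rw [qNorm, Finset.mul_sum]
    congr 1
    · rw [← self_mul_sign]; ring
    · refine Finset.sum_congr rfl fun i _ => ?_
      rw [← self_mul_sign]; ring
  · intro h z hz
    rw [dotProduct, Fin.sum_univ_succ]
    refine le_trans ?_ h
    rw [qNorm, Finset.mul_sum]
    refine add_le_add ?_ (Finset.sum_le_sum fun i _ => ?_)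
    · calc v 0 * z 0 ≤ |v 0 * z 0| := le_abs_self _
        _ = |z 0| * |v 0| := by rw [abs_mul, mul_comm]
        _ ≤ _ := mul_le_mul_of_nonneg_right hz.1 (abs_nonneg _)
    · calc v i.succ * z i.succ ≤ |v i.succ * z i.succ| := le_abs_self _
        _ = |z i.succ| * |v i.succ| := by rw [abs_mul, mul_comm]
        _ ≤ _ := mul_le_mul_of_nonneg_right (hz.2 i) (abs_nonneg _)

theorem mem_smul_dualBody_iff (n : ℕ) {Q l : ℝ} (hQ : 0 < Q) (hl : 0 < l)
    (v : Fin (n + 1) → ℝ) :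
    v ∈ l • dualBody (parallelepipedK n Q) ↔ qNorm n Q v ≤ l := by
  rw [Set.mem_smul_set_iff_inv_smul_mem₀ hl.ne', mem_dualBody_parallelepipedK_iff n hQ,
    qNorm_smul, abs_of_pos (inv_pos.2 hl), inv_mul_le_iff₀ hl, mul_one]

/-! ### The lattice of integer polynomials -/

/-- The set `Λ*` as an additive subgroup. -/
def dualLatticeSubgroup (n : ℕ) (ζ : ℝ) : AddSubgroup (Fin (n + 1) → ℝ) where
  carrier := dualLattice n ζ
  zero_mem' := ⟨0, 0, by simp, by simp⟩
  add_mem' := by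
    rintro a b ⟨x, y, h0, h⟩ ⟨x', y', h0', h'⟩
    refine ⟨x + x', y + y', ?_, fun i => by simp [h, h']⟩
    simp only [Pi.add_apply, h0, h0', Int.cast_add, mul_add, Finset.sum_add_distrib]
    ring
  neg_mem' := by
    rintro a ⟨x, y, h0, h⟩
    refine ⟨-x, -y, ?_, fun i => by simp [h]⟩
    simp only [Pi.neg_apply, h0, Int.cast_neg, mul_neg, Finset.sum_neg_distrib]
    ring

/-- The first coordinate of a point of `Λ*` is `P(ζ)` for an integer polynomial `P` of degree at
most `n`, hence it does not vanish unless the point does. -/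
theorem dualLattice_apply_zero_ne_zero {n : ℕ} {ζ : ℝ}
    (hζ : ¬ (IsAlgebraic ℚ ζ ∧ (minpoly ℚ ζ).natDegree ≤ n)) {v : Fin (n + 1) → ℝ}
    (hv : v ∈ dualLattice n ζ) (hv0 : v ≠ 0) : v 0 ≠ 0 := by
  intro h0
  obtain ⟨x, y, hx, hy⟩ := hv
  set P : Polynomial ℚ := Polynomial.C (x : ℚ) +
    ∑ i : Fin n, Polynomial.C (y i : ℚ) * Polynomial.X ^ ((i : ℕ) + 1) with hP
  have heval : Polynomial.aeval ζ P = 0 := by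
    rw [hx] at h0
    rw [← h0, hP]
    simp [map_sum, mul_comm]
  have hne : P ≠ 0 := by
    intro hP0
    have hc0 : P.coeff 0 = x := by
      simp [hP, Polynomial.finsetSum_coeff, Polynomial.coeff_X_pow]
    have hcs : ∀ i : Fin n, P.coeff (i + 1) = y i := by
      intro i
      rw [hP, Polynomial.coeff_add, Polynomial.finsetSum_coeff, Polynomial.coeff_C_succ]
      simp only [Polynomial.coeff_C_mul, Polynomial.coeff_X_pow, add_left_inj, Fin.val_inj]
      simp
    apply hv0
    have hy0 : ∀ i, y i = 0 := fun i => by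
      have := hcs i
      rw [hP0, Polynomial.coeff_zero] at this
      exact_mod_cast this.symm
    funext i
    refine Fin.cases h0 (fun i => ?_) i
    simp [hy, hy0]
  have hdeg : P.natDegree ≤ n := by
    rw [hP]
    refine Polynomial.natDegree_add_le_of_degree_le (by simp) ?_
    refine Polynomial.natDegree_sum_le_of_forall_le _ _ fun i _ => ?_
    refine (Polynomial.natDegree_C_mul_X_pow_le _ _).trans ?_
    omega
  exact hζ ⟨⟨P, hne, heval⟩, (Polynomial.natDegree_le_natDegree
    (minpoly.degree_le_of_ne_zero ℚ ζ hne heval)).trans hdeg⟩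

/-- The standard basis of `Λ*`, corresponding to the monomials `1, T, …, Tⁿ`. -/
noncomputable def monomialPoint (n : ℕ) (ζ : ℝ) : Fin (n + 1) → Fin (n + 1) → ℝ :=
  Fin.cons (Pi.single 0 1) fun i : Fin n => ζ ^ ((i : ℕ) + 1) • Pi.single 0 1 + Pi.single i.succ 1

theorem monomialPoint_mem (n : ℕ) (ζ : ℝ) (i : Fin (n + 1)) :
    monomialPoint n ζ i ∈ dualLattice n ζ := by
  refine Fin.cases ⟨1, 0, by simp [monomialPoint], by simp [monomialPoint]⟩ (fun i => ?_) i
  refine ⟨0, Pi.single i 1, ?_, fun k => ?_⟩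
  · simp [monomialPoint, Pi.single_apply]
  · simp [monomialPoint, Pi.single_apply]

theorem linearIndependent_monomialPoint (n : ℕ) (ζ : ℝ) :
    LinearIndependent ℝ (monomialPoint n ζ) := by
  rw [Fintype.linearIndependent_iff]
  intro g hg
  rw [Fin.sum_univ_succ] at hg
  have hs : ∀ k : Fin n, g k.succ = 0 := fun k => by
    simpa [monomialPoint, Pi.single_apply] using congrFun hg k.succ
  have h0 : g 0 = 0 := by
    simpa [hs, monomialPoint] using congrFun hg 0
  exact fun i => Fin.cases h0 hs i

/-- A factor `C` for which `C * Q` bounds the gauge of every monomial point. -/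
noncomputable def monomialBound (n : ℕ) (ζ : ℝ) : ℝ :=
  2 + ∑ i : Fin n, |ζ| ^ ((i : ℕ) + 1)

theorem two_le_monomialBound (n : ℕ) (ζ : ℝ) : 2 ≤ monomialBound n ζ := by
  unfold monomialBound
  linarith [Finset.sum_nonneg fun (i : Fin n) (_ : i ∈ Finset.univ) =>
    pow_nonneg (abs_nonneg ζ) ((i : ℕ) + 1)]

theorem qNorm_single_succ (n : ℕ) (Q : ℝ) (i : Fin n) :
    qNorm n Q (Pi.single i.succ 1) = Q ^ (-(1 / (n : ℝ))) := by
  have h : ∀ k : Fin n, |(Pi.single i.succ 1 : Fin (n + 1) → ℝ) k.succ| =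
      if k = i then 1 else 0 := fun k => by
    by_cases hk : k = i <;> simp [hk]
  rw [qNorm, Finset.sum_congr rfl fun k _ => h k]
  simp

theorem qNorm_single_zero (n : ℕ) (Q : ℝ) : qNorm n Q (Pi.single 0 1) = Q := by
  simp [qNorm]

theorem rpow_neg_inv_le_one (n : ℕ) {Q : ℝ} (hQ : 1 ≤ Q) : Q ^ (-(1 / (n : ℝ))) ≤ 1 :=
  Real.rpow_le_one_of_one_le_of_nonpos hQ (by simp)

theorem qNorm_monomialPoint_le (n : ℕ) (ζ : ℝ) {Q : ℝ} (hQ : 1 ≤ Q) (i : Fin (n + 1)) :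
    qNorm n Q (monomialPoint n ζ i) ≤ monomialBound n ζ * Q := by
  have hQ0 : 0 < Q := by linarith
  refine Fin.cases ?_ (fun i => ?_) i
  · rw [monomialPoint, Fin.cons_zero, qNorm_single_zero]
    nlinarith [two_le_monomialBound n ζ]
  · rw [monomialPoint, Fin.cons_succ]
    refine (qNorm_add_le n hQ0 _ _).trans ?_
    rw [qNorm_smul, qNorm_single_zero, qNorm_single_succ, abs_pow, monomialBound, add_mul,
      add_comm]
    have h1 := rpow_neg_inv_le_one n hQ
    have h2 := Finset.single_le_sum (f := fun i : Fin n => |ζ| ^ ((i : ℕ) + 1))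
      (fun k _ => pow_nonneg (abs_nonneg ζ) _) (Finset.mem_univ i)
    have h3 := mul_le_mul_of_nonneg_right h2 hQ0.le
    linarith

/-- An integer point either has a nonzero coefficient `yᵢ`, or is a nonzero constant. -/
theorem rpow_le_qNorm {n : ℕ} {ζ Q : ℝ} (hQ : 1 ≤ Q) {v : Fin (n + 1) → ℝ}
    (hv : v ∈ dualLattice n ζ) (hv0 : v ≠ 0) : Q ^ (-(1 / (n : ℝ))) ≤ qNorm n Q v := by
  obtain ⟨x, y, hx, hy⟩ := hv
  have hQ0 : 0 < Q := by linarith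
  have hq : 0 < Q ^ (-(1 / (n : ℝ))) := Real.rpow_pos_of_pos hQ0 _
  by_cases h : ∃ i, y i ≠ 0
  · obtain ⟨i, hi⟩ := h
    have h1 : (1 : ℝ) ≤ |v i.succ| := by
      rw [hy]; exact_mod_cast Int.one_le_abs hi
    have h2 := Finset.single_le_sum (f := fun i : Fin n => |v i.succ|)
      (fun k _ => abs_nonneg _) (Finset.mem_univ i)
    have h3 : 0 ≤ Q * |v 0| := by positivity
    unfold qNorm
    nlinarith [mul_le_mul_of_nonneg_left (h1.trans h2) hq.le]
  · push Not at h
    have hx0 : x ≠ 0 := by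
      rintro rfl
      apply hv0
      funext i
      refine Fin.cases ?_ (fun i => ?_) i
      · simp [hx, h]
      · simp [hy, h]
    have h1 : (1 : ℝ) ≤ |v 0| := by
      rw [hx]; simp only [h, Int.cast_zero, mul_zero, Finset.sum_const_zero, add_zero]
      exact_mod_cast Int.one_le_abs hx0
    have h3 : 0 ≤ Q ^ (-(1 / (n : ℝ))) * ∑ i : Fin n, |v i.succ| := by positivity
    unfold qNorm
    nlinarith [rpow_neg_inv_le_one n hQ, mul_le_mul_of_nonneg_left h1 hQ0.le]

/-! ### Elementary bounds for the successive minima -/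

theorem dualLambda_le {n : ℕ} {ζ Q l : ℝ} {j : ℕ} (hQ : 0 < Q) (hl : 0 < l)
    (v : Fin j → Fin (n + 1) → ℝ) (hv : LinearIndependent ℝ v)
    (h : ∀ i, v i ∈ smallPoints n ζ Q l) : dualLambda n ζ j Q ≤ l :=
  csInf_le ⟨0, fun _ hx => hx.1.le⟩
    ⟨hl, v, hv, fun i => ⟨(h i).1, (mem_smul_dualBody_iff n hQ hl _).2 (h i).2⟩⟩

theorem dualLambda_le_monomialBound {n : ℕ} {ζ Q : ℝ} {j : ℕ} (hQ : 1 ≤ Q) (hj : j ≤ n + 1) :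
    dualLambda n ζ j Q ≤ monomialBound n ζ * Q :=
  dualLambda_le (by linarith) (by nlinarith [two_le_monomialBound n ζ])
    (monomialPoint n ζ ∘ Fin.castLE hj)
    ((linearIndependent_monomialPoint n ζ).comp _ (Fin.castLE_injective hj))
    fun i => ⟨monomialPoint_mem _ _ _, qNorm_monomialPoint_le n ζ hQ _⟩

theorem le_dualLambda {n : ℕ} {ζ Q : ℝ} {j : ℕ} (hQ : 1 ≤ Q) (hj1 : 1 ≤ j) (hj : j ≤ n + 1) :
    Q ^ (-(1 / (n : ℝ))) ≤ dualLambda n ζ j Q := by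
  have hQ0 : 0 < Q := by linarith
  have hC : 0 < monomialBound n ζ * Q := by nlinarith [two_le_monomialBound n ζ]
  refine le_csInf ⟨monomialBound n ζ * Q, hC, monomialPoint n ζ ∘ Fin.castLE hj,
    (linearIndependent_monomialPoint n ζ).comp _ (Fin.castLE_injective hj), fun i =>
      ⟨monomialPoint_mem _ _ _,
        (mem_smul_dualBody_iff n hQ0 hC _).2 (qNorm_monomialPoint_le n ζ hQ _)⟩⟩ ?_
  rintro l ⟨hl, v, hv, h⟩
  exact (rpow_le_qNorm hQ (h ⟨0, hj1⟩).1 (hv.ne_zero _)).trans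
    ((mem_smul_dualBody_iff n hQ0 hl _).1 (h ⟨0, hj1⟩).2)

theorem dualPsi_le_of_dualLambda_le {n : ℕ} {ζ Q t : ℝ} {j : ℕ} (hQ : 1 < Q) (hj1 : 1 ≤ j)
    (hj : j ≤ n + 1) (h : dualLambda n ζ j Q ≤ Q ^ t) : dualPsi n ζ j Q ≤ t :=
  (Real.logb_le_iff_le_rpow hQ ((Real.rpow_pos_of_pos (by linarith) _).trans_le
    (le_dualLambda hQ.le hj1 hj))).2 h

theorem neg_le_dualPsi {n : ℕ} {ζ Q : ℝ} {j : ℕ} (hQ : 1 < Q) (hj1 : 1 ≤ j)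
    (hj : j ≤ n + 1) : -(1 / (n : ℝ)) ≤ dualPsi n ζ j Q :=
  (Real.le_logb_iff_rpow_le hQ ((Real.rpow_pos_of_pos (by linarith) _).trans_le
    (le_dualLambda hQ.le hj1 hj))).2 (le_dualLambda hQ.le hj1 hj)

theorem dualPsi_le_two {n : ℕ} {ζ Q : ℝ} {j : ℕ} (hQ : monomialBound n ζ ≤ Q) (hj1 : 1 ≤ j)
    (hj : j ≤ n + 1) : dualPsi n ζ j Q ≤ 2 := by
  have h2 := two_le_monomialBound n ζ
  refine dualPsi_le_of_dualLambda_le (by linarith) hj1 hj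
    ((dualLambda_le_monomialBound (by linarith) hj).trans ?_)
  rw [Real.rpow_two]
  nlinarith

theorem isBoundedUnder_le_dualPsi {n : ℕ} (ζ : ℝ) {j : ℕ} (hj1 : 1 ≤ j) (hj : j ≤ n + 1) :
    IsBoundedUnder (· ≤ ·) atTop (dualPsi n ζ j) :=
  isBoundedUnder_of_eventually_le ((eventually_ge_atTop (monomialBound n ζ)).mono
    fun _ hQ => dualPsi_le_two hQ hj1 hj)

theorem isBoundedUnder_ge_dualPsi {n : ℕ} (ζ : ℝ) {j : ℕ} (hj1 : 1 ≤ j) (hj : j ≤ n + 1) :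
    IsBoundedUnder (· ≥ ·) atTop (dualPsi n ζ j) :=
  isBoundedUnder_of_eventually_ge ((eventually_gt_atTop 1).mono
    fun _ hQ => neg_le_dualPsi hQ hj1 hj)

/-! ### Counting and packing -/

/-- Volume packing: the balls of radius `ε / 2` around `ε`-separated points are disjoint. -/
theorem card_le_pow_finrank_of_separated {ι E : Type*} [NormedAddCommGroup E] [NormedSpace ℝ E]
    [FiniteDimensional ℝ E] (s : Finset ι) (f : ι → E) {R ε : ℝ} (hR : 0 ≤ R) (hε : 0 < ε)
    (hs : ∀ i ∈ s, ‖f i‖ ≤ R) (h : ∀ i ∈ s, ∀ j ∈ s, i ≠ j → ε ≤ ‖f i - f j‖) :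
    (s.card : ℝ) ≤ (1 + 2 * R / ε) ^ Module.finrank ℝ E := by
  borelize E
  let μ : MeasureTheory.Measure E := MeasureTheory.Measure.addHaar
  have hδ : 0 < ε / 2 := by positivity
  have hρ : 0 < R + ε / 2 := by positivity
  have hD : (s : Set ι).Pairwise
      (Function.onFun Disjoint fun i => Metric.ball (f i) (ε / 2)) := by
    intro i hi j hj hij
    refine Metric.ball_disjoint_ball ?_
    rw [dist_eq_norm, add_halves]
    exact h i hi j hj hij
  have hsub : ⋃ i ∈ s, Metric.ball (f i) (ε / 2) ⊆ Metric.ball (0 : E) (R + ε / 2) := by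
    refine Set.iUnion₂_subset fun i hi => Metric.ball_subset_ball' ?_
    rw [dist_zero_right]
    linarith [hs i hi]
  have I := MeasureTheory.measure_mono (μ := μ) hsub
  rw [MeasureTheory.measure_biUnion_finset hD fun i _ => measurableSet_ball] at I
  simp only [μ.addHaar_ball_of_pos _ hδ, μ.addHaar_ball_of_pos _ hρ, Finset.sum_const,
    nsmul_eq_mul, ← mul_assoc] at I
  have J := (ENNReal.mul_le_mul_iff_left (Metric.measure_ball_pos _ _ zero_lt_one).ne'
    MeasureTheory.measure_ball_lt_top.ne).1 I
  have K := ENNReal.toReal_le_of_le_ofReal (pow_nonneg hρ.le _) J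
  rw [ENNReal.toReal_mul, ENNReal.toReal_natCast,
    ENNReal.toReal_ofReal (pow_nonneg hδ.le _), ← le_div_iff₀ (pow_pos hδ _), ← div_pow] at K
  have e : (R + ε / 2) / (ε / 2) = 1 + 2 * R / ε := by
    field_simp
    ring
  rwa [e] at K

/-- Pigeonhole: the coefficients `yᵢ ∈ [0, B Q^(1/n)]` give about `Bⁿ Q` polynomials with value at
`ζ` in `[0, 1)`, and many of these values lie in a common interval of length `B / Q`. -/
theorem exists_many_smallPoints {n : ℕ} (hn : 1 ≤ n) (ζ : ℝ) {Q B : ℝ} (hB : 1 ≤ B)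
    (hBQ : B ≤ Q) : ∃ S : Finset (Fin (n + 1) → ℝ),
      (∀ v ∈ S, v ∈ smallPoints n ζ Q ((n + 1) * B)) ∧ B ^ (n + 1) / 2 ≤ S.card := by
  classical
  have hB0 : 0 < B := by linarith
  have hQ0 : 0 < Q := by linarith
  set M : ℕ := ⌊B * Q ^ (1 / (n : ℝ))⌋₊ with hM
  set R : ℕ := ⌈Q / B⌉₊ with hR
  have hR0 : 0 < R := Nat.ceil_pos.2 (by positivity)
  have hR0' : (0 : ℝ) < R := by exact_mod_cast hR0
  have hRle : (R : ℝ) ≤ 2 * (Q / B) := by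
    have h1 := (Nat.ceil_lt_add_one (a := Q / B) (by positivity)).le
    have h2 : 1 ≤ Q / B := (one_le_div hB0).2 hBQ
    linarith
  have hRge : Q / B ≤ R := Nat.le_ceil _
  let s : (Fin n → Fin (M + 1)) → ℝ := fun y => ∑ i : Fin n, ζ ^ ((i : ℕ) + 1) * ((y i : ℕ) : ℝ)
  let cell : (Fin n → Fin (M + 1)) → ℕ := fun y => ⌊Int.fract (s y) * R⌋₊
  have hcell : ∀ y ∈ (Finset.univ : Finset (Fin n → Fin (M + 1))), cell y ∈ Finset.range R := by
    intro y _
    rw [Finset.mem_range]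
    refine (Nat.floor_lt (mul_nonneg (Int.fract_nonneg _) hR0'.le)).2 ?_
    exact mul_lt_of_lt_one_left hR0' (Int.fract_lt_one _)
  have hcount : (Finset.range R).card • (B ^ (n + 1) / 2) ≤
      ((Finset.univ : Finset (Fin n → Fin (M + 1))).card : ℝ) := by
    have h1 : B * Q ^ (1 / (n : ℝ)) ≤ (M : ℝ) + 1 := (Nat.lt_floor_add_one _).le
    have h2 := pow_le_pow_left₀ (by positivity) h1 n
    have h3 : (Q ^ (1 / (n : ℝ))) ^ n = Q := by
      rw [one_div]
      exact Real.rpow_inv_natCast_pow hQ0.le (by omega)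
    rw [mul_pow, h3] at h2
    simp only [Finset.card_range, nsmul_eq_mul, Finset.card_univ, Fintype.card_fun,
      Fintype.card_fin]
    push_cast
    refine le_trans ?_ h2
    calc (R : ℝ) * (B ^ (n + 1) / 2) ≤ 2 * (Q / B) * (B ^ (n + 1) / 2) := by gcongr
      _ = B ^ n * Q := by field_simp; ring
  obtain ⟨c, -, hc⟩ := Finset.exists_le_card_fiber_of_nsmul_le_card_of_maps_to hcell
    ⟨0, Finset.mem_range.2 hR0⟩ hcount
  set F := Finset.univ.filter fun y => cell y = c with hF
  have hFne : F.Nonempty := by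
    rw [← Finset.card_pos]
    have : (0 : ℝ) < B ^ (n + 1) / 2 := by positivity
    exact_mod_cast this.trans_le hc
  obtain ⟨y₀, hy₀⟩ := hFne
  let g : (Fin n → Fin (M + 1)) → Fin (n + 1) → ℝ := fun y =>
    Fin.cons (Int.fract (s y) - Int.fract (s y₀)) fun i => ((y i : ℕ) : ℝ) - ((y₀ i : ℕ) : ℝ)
  have hg : Function.Injective g := by
    intro y y' h
    funext i
    have := congrFun h i.succ
    simp only [g, Fin.cons_succ, sub_left_inj, Nat.cast_inj] at this
    exact Fin.ext this
  refine ⟨F.image g, ?_, by rwa [Finset.card_image_of_injective _ hg]⟩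
  intro v hv
  obtain ⟨y, hy, rfl⟩ := Finset.mem_image.1 hv
  have hyc : cell y = cell y₀ := by
    rw [(Finset.mem_filter.1 hy).2, (Finset.mem_filter.1 hy₀).2]
  refine ⟨⟨⌊s y₀⌋ - ⌊s y⌋, fun i => (y i : ℕ) - (y₀ i : ℕ), ?_, fun i => ?_⟩, ?_⟩
  · simp only [g, Fin.cons_zero, Int.fract, Int.cast_sub, Int.cast_natCast, mul_sub,
      Finset.sum_sub_distrib, s]
    ring
  · simp [g]
  · have h0 : |g y 0| ≤ B / Q := by
      have h1 : |Int.fract (s y) * R - Int.fract (s y₀) * R| < 1 := by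
        have e1 := Nat.floor_le (mul_nonneg (Int.fract_nonneg (s y)) hR0'.le)
        have e2 := Nat.lt_floor_add_one (Int.fract (s y) * R)
        have e3 := Nat.floor_le (mul_nonneg (Int.fract_nonneg (s y₀)) hR0'.le)
        have e4 := Nat.lt_floor_add_one (Int.fract (s y₀) * R)
        have e5 : (⌊Int.fract (s y) * R⌋₊ : ℝ) = ⌊Int.fract (s y₀) * R⌋₊ := by
          exact_mod_cast hyc
        rw [abs_lt]
        constructor <;> linarith
      rw [← sub_mul, abs_mul, abs_of_pos hR0'] at h1
      simp only [g, Fin.cons_zero]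
      calc |Int.fract (s y) - Int.fract (s y₀)| ≤ 1 / R := ((lt_div_iff₀ hR0').2 h1).le
        _ ≤ 1 / (Q / B) := one_div_le_one_div_of_le (by positivity) hRge
        _ = B / Q := by rw [one_div_div]
    have hi : ∀ i : Fin n, |g y i.succ| ≤ B * Q ^ (1 / (n : ℝ)) := by
      intro i
      have hM' : (M : ℝ) ≤ B * Q ^ (1 / (n : ℝ)) := Nat.floor_le (by positivity)
      refine le_trans ?_ hM'
      have e1 : ((y i : ℕ) : ℝ) ≤ M := by exact_mod_cast Nat.lt_succ_iff.1 (y i).2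
      have e2 : ((y₀ i : ℕ) : ℝ) ≤ M := by exact_mod_cast Nat.lt_succ_iff.1 (y₀ i).2
      have e3 : (0 : ℝ) ≤ ((y i : ℕ) : ℝ) := Nat.cast_nonneg _
      have e4 : (0 : ℝ) ≤ ((y₀ i : ℕ) : ℝ) := Nat.cast_nonneg _
      simp only [g, Fin.cons_succ]
      rw [abs_le]
      constructor <;> linarith
    have hsum := Finset.sum_le_sum fun (i : Fin n) (_ : i ∈ Finset.univ) => hi i
    rw [Finset.sum_const, Finset.card_univ, Fintype.card_fin, nsmul_eq_mul] at hsum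
    calc qNorm n Q (g y) ≤ Q * (B / Q) +
          Q ^ (-(1 / (n : ℝ))) * (n * (B * Q ^ (1 / (n : ℝ)))) := by
          unfold qNorm; gcongr
      _ = (n + 1) * B := by
          have : Q ^ (-(1 / (n : ℝ))) * Q ^ (1 / (n : ℝ)) = 1 := by
            rw [← Real.rpow_add hQ0]; simp
          rw [mul_div_cancel₀ _ hQ0.ne']
          linear_combination (n * B) * this

/-- One nonzero small point bounds the first minimum. -/
theorem dualLambda_one_le {n : ℕ} {ζ Q l : ℝ} (hQ : 0 < Q) (hl : 0 < l) {v : Fin (n + 1) → ℝ}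
    (hv : v ∈ smallPoints n ζ Q l) (hv0 : v ≠ 0) : dualLambda n ζ 1 Q ≤ l :=
  dualLambda_le hQ hl (fun _ => v) (LinearIndependent.of_subsingleton 0 hv0) fun _ => hv

/-- A form of Minkowski's first theorem. -/
theorem dualLambda_one_le_const {n : ℕ} (hn : 1 ≤ n) (ζ : ℝ) {Q : ℝ} (hQ : 2 ≤ Q) :
    dualLambda n ζ 1 Q ≤ (n + 1) * 2 + (n + 1) * 2 := by
  obtain ⟨S, hS, hcard⟩ := exists_many_smallPoints hn ζ one_le_two hQ
  have h1 : 1 < S.card := by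
    have : (2 : ℝ) ^ 2 ≤ 2 ^ (n + 1) := pow_le_pow_right₀ one_le_two (by omega)
    have h2 : (1 : ℝ) < S.card := by linarith
    exact_mod_cast h2
  obtain ⟨v, hv, w, hw, hvw⟩ := Finset.one_lt_card.1 h1
  refine dualLambda_one_le (by linarith) (by positivity) (v := v - w)
    ⟨(dualLatticeSubgroup n ζ).sub_mem (hS v hv).1 (hS w hw).1, ?_⟩ (sub_ne_zero.2 hvw)
  have h3 := qNorm_add_le n (Q := Q) (by linarith) v ((-1 : ℝ) • w)
  rw [qNorm_smul, abs_neg, abs_one, one_mul, neg_one_smul, ← sub_eq_add_neg] at h3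
  linarith [(hS v hv).2, (hS w hw).2]

/-- The diagonal map turning `qNorm n Q` into the standard `ℓ¹`-norm. -/
noncomputable def qScale (n : ℕ) (Q : ℝ) : (Fin (n + 1) → ℝ) →ₗ[ℝ] (Fin (n + 1) → ℝ) where
  toFun v := Fin.cons (Q * v 0) fun i => Q ^ (-(1 / (n : ℝ))) * v i.succ
  map_add' v w := by
    funext i
    refine Fin.cases ?_ (fun i => ?_) i <;> simp [mul_add]
  map_smul' c v := by
    funext i
    refine Fin.cases ?_ (fun i => ?_) i <;> simp [mul_left_comm]

theorem qNorm_eq_sum_qScale (n : ℕ) {Q : ℝ} (hQ : 0 < Q) (v : Fin (n + 1) → ℝ) :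
    qNorm n Q v = ∑ i, |qScale n Q v i| := by
  have hq : 0 < Q ^ (-(1 / (n : ℝ))) := Real.rpow_pos_of_pos hQ _
  rw [Fin.sum_univ_succ, qNorm, Finset.mul_sum]
  congr 1
  · change _ = |Q * v 0|
    rw [abs_mul, abs_of_pos hQ]
  · refine Finset.sum_congr rfl fun i _ => ?_
    change _ = |Q ^ (-(1 / (n : ℝ))) * v i.succ|
    rw [abs_mul, abs_of_pos hq]

theorem norm_qScale_le (n : ℕ) {Q : ℝ} (hQ : 0 < Q) (v : Fin (n + 1) → ℝ) :
    ‖qScale n Q v‖ ≤ qNorm n Q v := by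
  refine (pi_norm_le_iff_of_nonneg (qNorm_nonneg n hQ v)).2 fun i => ?_
  rw [qNorm_eq_sum_qScale n hQ]
  exact Finset.single_le_sum (f := fun i => |qScale n Q v i|) (fun k _ => abs_nonneg _)
    (Finset.mem_univ i)

theorem qNorm_le_norm_qScale (n : ℕ) {Q : ℝ} (hQ : 0 < Q) (v : Fin (n + 1) → ℝ) :
    qNorm n Q v ≤ (n + 1) * ‖qScale n Q v‖ := by
  rw [qNorm_eq_sum_qScale n hQ]
  calc ∑ i, |qScale n Q v i| ≤ ∑ _i : Fin (n + 1), ‖qScale n Q v‖ :=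
        Finset.sum_le_sum fun i _ => norm_le_pi_norm (qScale n Q v) i
    _ = _ := by simp

/-- If the many lattice points of `(n + 1) B • K*(Q)` lie in a subspace of dimension less than `n`,
then two of them are close to each other, and their difference bounds the first minimum. -/
theorem dualLambda_one_le_of_finrank_lt {n : ℕ} (hn : 1 ≤ n) {ζ Q B ε : ℝ} (hB : 1 ≤ B)
    (hBQ : B ≤ Q) (hε : 0 < ε)
    (hd : Module.finrank ℝ (Submodule.span ℝ (smallPoints n ζ Q ((n + 1) * B))) ≤ n - 1)
    (h : (1 + 2 * (n + 1) ^ 2 * B / ε) ^ (n - 1) < B ^ (n + 1) / 2) :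
    dualLambda n ζ 1 Q ≤ ε := by
  have hQ : 0 < Q := by linarith
  by_contra! hlt
  obtain ⟨S, hS, hcard⟩ := exists_many_smallPoints hn ζ hB hBQ
  set U := Submodule.span ℝ (smallPoints n ζ Q ((n + 1) * B))
  set f : S → U.map (qScale n Q) := fun v =>
    ⟨qScale n Q v, Submodule.mem_map_of_mem (Submodule.subset_span (hS v v.2))⟩ with hf
  have key := card_le_pow_finrank_of_separated S.attach f (R := (n + 1) * B)
    (ε := ε / (n + 1)) (by positivity) (by positivity)
    (fun v _ => (norm_qScale_le n hQ v).trans (hS v v.2).2) (by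
      intro v _ w _ hvw
      have hne : (v : Fin (n + 1) → ℝ) - w ≠ 0 := sub_ne_zero.2 fun h => hvw (Subtype.ext h)
      have h1 : ε ≤ qNorm n Q ((v : Fin (n + 1) → ℝ) - w) := by
        by_contra! h2
        exact hlt.not_ge (dualLambda_one_le hQ hε
          ⟨(dualLatticeSubgroup n ζ).sub_mem (hS v v.2).1 (hS w w.2).1, h2.le⟩ hne)
      have h2 := h1.trans (qNorm_le_norm_qScale n hQ _)
      rw [div_le_iff₀' (by positivity)]
      rwa [map_sub] at h2)
  rw [Finset.card_attach] at key
  have e : 2 * (((n : ℝ) + 1) * B) / (ε / (n + 1)) = 2 * (n + 1) ^ 2 * B / ε := by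
    field_simp
  rw [e] at key
  have h1 : 1 ≤ 1 + 2 * ((n : ℝ) + 1) ^ 2 * B / ε := by
    have : 0 ≤ 2 * ((n : ℝ) + 1) ^ 2 * B / ε := by positivity
    linarith
  have h2 := pow_le_pow_right₀ h1 ((Submodule.finrank_map_le (qScale n Q) U).trans hd)
  linarith

/-- The quantitative form: `λ*₁ ≪ B^(-2/(n-1))` when the lattice points of `(n + 1) B • K*(Q)`
lie in a subspace of dimension less than `n`. -/
theorem dualLambda_one_le_rpow {n : ℕ} (hn : 2 ≤ n) {ζ Q B : ℝ} (hB : 5 ≤ B) (hBQ : B ≤ Q)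
    (hd : Module.finrank ℝ (Submodule.span ℝ (smallPoints n ζ Q ((n + 1) * B))) ≤ n - 1) :
    dualLambda n ζ 1 Q ≤ 8 * (n + 1) ^ 2 * B ^ (-(2 / ((n : ℝ) - 1))) := by
  have hB0 : 0 < B := by linarith
  have hn1 : (0 : ℝ) < (n : ℝ) - 1 := by
    have : (2 : ℝ) ≤ n := by exact_mod_cast hn
    linarith
  refine dualLambda_one_le_of_finrank_lt (by omega) (by linarith) hBQ (by positivity) hd ?_
  -- with `ρ = B^((n+1)/(n-1))` the claim reads `(1 + ρ / 4)^(n-1) < ρ^(n-1) / 2`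
  set ρ : ℝ := B ^ (((n : ℝ) + 1) / ((n : ℝ) - 1)) with hρ
  have hρpow : ρ ^ (n - 1) = B ^ (n + 1) := by
    rw [hρ, ← Real.rpow_natCast, ← Real.rpow_mul hB0.le, ← Real.rpow_natCast,
      Nat.cast_sub (by omega : 1 ≤ n)]
    push_cast
    rw [div_mul_cancel₀ _ hn1.ne']
  have hρ5 : 5 ≤ ρ := hB.trans (Real.self_le_rpow_of_one_le (by linarith)
    ((one_le_div hn1).2 (by linarith)))
  have e : 2 * ((n : ℝ) + 1) ^ 2 * B / (8 * (n + 1) ^ 2 * B ^ (-(2 / ((n : ℝ) - 1)))) =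
      ρ / 4 := by
    have : ρ = B * B ^ (2 / ((n : ℝ) - 1)) := by
      rw [hρ, ← Real.rpow_one_add' hB0.le (by positivity)]
      congr 1
      field_simp
      ring
    rw [Real.rpow_neg hB0.le, this]
    field_simp
    norm_num
  rw [e]
  calc (1 + ρ / 4) ^ (n - 1) < (ρ / 2) ^ (n - 1) :=
        pow_lt_pow_left₀ (by linarith) (by positivity) (by omega)
    _ = ρ ^ (n - 1) * (1 / 2) ^ (n - 1) := by rw [← mul_pow]; ring
    _ ≤ ρ ^ (n - 1) * (1 / 2) := by
        gcongr
        exact pow_le_of_le_one (by norm_num) (by norm_num) (by omega)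
    _ = B ^ (n + 1) / 2 := by rw [hρpow]; ring

/-! ### The span of the small lattice points -/

theorem smallPoints_mono {n : ℕ} {ζ Q B B' : ℝ} (h : B ≤ B') :
    smallPoints n ζ Q B ⊆ smallPoints n ζ Q B' := fun _ hv => ⟨hv.1, hv.2.trans h⟩

theorem qNorm_le_two_mul_qNorm {n : ℕ} (hn : 1 ≤ n) {Q : ℝ} (hQ : 0 < Q)
    (v : Fin (n + 1) → ℝ) : qNorm n Q v ≤ 2 * qNorm n (2 * Q) v := by
  have hq : 0 < Q ^ (-(1 / (n : ℝ))) := Real.rpow_pos_of_pos hQ _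
  have h1 : Q ^ (-(1 / (n : ℝ))) ≤ 2 * (2 * Q) ^ (-(1 / (n : ℝ))) := by
    rw [Real.mul_rpow zero_le_two hQ.le, ← mul_assoc]
    refine le_mul_of_one_le_left hq.le ?_
    have h : 1 / (n : ℝ) ≤ 1 := by
      rw [div_le_one (by positivity)]; exact_mod_cast hn
    calc (1 : ℝ) ≤ 2 ^ (1 + -(1 / (n : ℝ))) := Real.one_le_rpow one_le_two (by linarith)
      _ = 2 * 2 ^ (-(1 / (n : ℝ))) := by rw [Real.rpow_add two_pos, Real.rpow_one]
  have h2 := mul_le_mul_of_nonneg_right h1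
    (Finset.sum_nonneg fun (i : Fin n) (_ : i ∈ Finset.univ) => abs_nonneg (v i.succ))
  have h3 : 0 ≤ Q * |v 0| := by positivity
  unfold qNorm
  linarith

/-- Rounding the coefficients of a vector in the span of small lattice points. -/
theorem exists_near_of_mem_span_smallPoints {n : ℕ} {ζ Q B : ℝ} (hQ : 0 < Q)
    {w : Fin (n + 1) → ℝ} (hw : w ∈ Submodule.span ℝ (smallPoints n ζ Q B)) :
    ∃ γ ∈ dualLattice n ζ, γ ∈ Submodule.span ℝ (smallPoints n ζ Q B) ∧
      qNorm n Q (w - γ) ≤ Module.finrank ℝ (Submodule.span ℝ (smallPoints n ζ Q B)) * B := by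
  obtain ⟨f, hf, hspan, -⟩ := Submodule.exists_fun_fin_finrank_span_eq ℝ (smallPoints n ζ Q B)
  rw [← hspan] at hw
  obtain ⟨c, rfl⟩ := (Submodule.mem_span_range_iff_exists_fun ℝ).1 hw
  refine ⟨∑ i, ⌊c i⌋ • f i, ?_, ?_, ?_⟩
  · exact (dualLatticeSubgroup n ζ).sum_mem fun i _ =>
      (dualLatticeSubgroup n ζ).zsmul_mem (hf i).1 _
  · exact Submodule.sum_mem _ fun i _ => zsmul_mem (Submodule.subset_span (hf i)) _
  · have e : ∑ i, c i • f i - ∑ i, ⌊c i⌋ • f i = ∑ i, Int.fract (c i) • f i := by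
      rw [← Finset.sum_sub_distrib]
      refine Finset.sum_congr rfl fun i _ => ?_
      rw [Int.fract, sub_smul, Int.cast_smul_eq_zsmul]
    rw [e]
    refine (qNorm_sum_le n hQ _ _).trans ((Finset.sum_le_sum fun i _ => ?_).trans_eq
      (b := ∑ _i : Fin (Module.finrank ℝ (Submodule.span ℝ (smallPoints n ζ Q B))), B) (by simp))
    rw [qNorm_smul, abs_of_nonneg (Int.fract_nonneg _)]
    exact (mul_le_of_le_one_left (qNorm_nonneg n hQ _) (Int.fract_lt_one _).le).trans (hf i).2

/-- If the lattice points of `Q^a • K*(Q)` never span, then the span of the lattice points of a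
fixed fraction of this body cannot be a hyperplane for all large `Q`: the hyperplane would not
depend on `Q`. A vector `u` off this hyperplane with `u 0 = 0` has gauge tending to `0`. Subtracting
a multiple of `u` from a lattice point `e` off the hyperplane and rounding the remaining part to
the lattice produces a small lattice point off the hyperplane. -/
theorem exists_finrank_span_smallPoints_le {n : ℕ} (hn : 2 ≤ n) {ζ : ℝ}
    (hζ : ¬ (IsAlgebraic ℚ ζ ∧ (minpoly ℚ ζ).natDegree ≤ n)) {a C Q₀ : ℝ}
    (hC1 : 2 * 2 ^ a ≤ C) (hC2 : 2 * n ≤ C) (hQ₀ : 1 ≤ Q₀) (ha : ∀ Q, Q₀ ≤ Q → 2 ≤ Q ^ a)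
    (h : ∀ Q, Q₀ ≤ Q → Submodule.span ℝ (smallPoints n ζ Q (Q ^ a)) ≠ ⊤) :
    ∃ Q, Q₀ ≤ Q ∧ Module.finrank ℝ (Submodule.span ℝ (smallPoints n ζ Q (Q ^ a / C))) ≤ n - 1 := by
  by_contra! hcon
  have hn0 : (2 : ℝ) ≤ n := by exact_mod_cast hn
  have hC0 : 0 < C := by linarith
  have hC4 : 1 ≤ C := by linarith
  let q : ℕ → ℝ := fun k => Q₀ * 2 ^ k
  have hq : ∀ k, Q₀ ≤ q k := fun k =>
    le_mul_of_one_le_right (by linarith) (one_le_pow₀ one_le_two)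
  let V : ℕ → Submodule ℝ (Fin (n + 1) → ℝ) := fun k =>
    Submodule.span ℝ (smallPoints n ζ (q k) (q k ^ a))
  let W : ℕ → Submodule ℝ (Fin (n + 1) → ℝ) := fun k =>
    Submodule.span ℝ (smallPoints n ζ (q k) (q k ^ a / C))
  have hWrank : ∀ k, n ≤ Module.finrank ℝ (W k) := fun k => by
    have := hcon (q k) (hq k)
    simp only [W]
    omega
  have hVrank : ∀ k, Module.finrank ℝ (V k) ≤ n := fun k => by
    have h1 := Submodule.finrank_lt (h (q k) (hq k))
    rw [Module.finrank_fin_fun] at h1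
    exact Nat.lt_succ_iff.1 h1
  have hWV : ∀ k, W k = V k := fun k => by
    have h0 : 0 ≤ q k ^ a := by linarith [ha _ (hq k)]
    exact Submodule.eq_of_le_of_finrank_le
      (Submodule.span_mono (smallPoints_mono (div_le_self h0 hC4)))
      ((hVrank k).trans (hWrank k))
  have hstep : ∀ k, W (k + 1) = V k := fun k => by
    have hqk : 0 < q k := by linarith [hq k]
    refine Submodule.eq_of_le_of_finrank_le (Submodule.span_mono fun v hv => ⟨hv.1, ?_⟩)
      ((hVrank k).trans (hWrank _))
    have e : q (k + 1) = 2 * q k := by simp only [q]; ring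
    have h1 := hv.2
    rw [e, Real.mul_rpow zero_le_two hqk.le, le_div_iff₀ hC0] at h1
    have h2 := qNorm_le_two_mul_qNorm (by omega : 1 ≤ n) hqk v
    have h3 := qNorm_nonneg n (mul_pos two_pos hqk) v
    have h4 : 0 < (2 : ℝ) ^ a := by positivity
    have h5 : qNorm n (2 * q k) v * (2 * 2 ^ a) ≤ 2 ^ a * q k ^ a :=
      (mul_le_mul_of_nonneg_left hC1 h3).trans h1
    have h6 : 2 ^ a * (2 * qNorm n (2 * q k) v) ≤ 2 ^ a * q k ^ a := by linarith
    exact h2.trans (le_of_mul_le_mul_left h6 h4)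
  have hconst : ∀ k, W k = W 0 := fun k => by
    induction k with
    | zero => rfl
    | succ k ih => rw [hstep, ← hWV, ih]
  have hne : W 0 ≠ ⊤ := by rw [hWV]; exact h _ (hq 0)
  -- a direction off the hyperplane along which the gauge is small
  obtain ⟨i, hi⟩ : ∃ i : Fin n, (Pi.single i.succ 1 : Fin (n + 1) → ℝ) ∉ W 0 := by
    by_contra! hall
    obtain ⟨v, hv, hv0⟩ : ∃ v ∈ smallPoints n ζ (q 0) (q 0 ^ a / C), v ≠ 0 := by
      by_contra! hz
      have : W 0 = ⊥ := Submodule.span_eq_bot.2 hz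
      have h1 := hWrank 0
      rw [this, finrank_bot] at h1
      omega
    have hvW : v ∈ W 0 := Submodule.subset_span hv
    have hdec : ∀ x : Fin (n + 1) → ℝ, x = x 0 • Pi.single 0 1 +
        ∑ k : Fin n, x k.succ • (Pi.single k.succ 1 : Fin (n + 1) → ℝ) := fun x => by
      rw [← Fin.sum_univ_succ (fun k => x k • (Pi.single k 1 : Fin (n + 1) → ℝ))]
      exact pi_eq_sum_univ' x
    have hsum : ∀ x : Fin (n + 1) → ℝ,
        ∑ k : Fin n, x k.succ • (Pi.single k.succ 1 : Fin (n + 1) → ℝ) ∈ W 0 := fun x =>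
      Submodule.sum_mem _ fun k _ => Submodule.smul_mem _ _ (hall k)
    have h0 : (Pi.single 0 1 : Fin (n + 1) → ℝ) ∈ W 0 := by
      rw [hdec v, Submodule.add_mem_iff_left _ (hsum v),
        Submodule.smul_mem_iff _ (dualLattice_apply_zero_ne_zero hζ hv.1 hv0)] at hvW
      exact hvW
    refine hne (eq_top_iff.2 fun x _ => ?_)
    rw [hdec x]
    exact Submodule.add_mem _ (Submodule.smul_mem _ _ h0) (hsum x)
  set u : Fin (n + 1) → ℝ := Pi.single i.succ 1
  obtain ⟨e, he, heW⟩ : ∃ e ∈ dualLattice n ζ, e ∉ W 0 := by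
    by_contra! hall
    refine hne (eq_top_iff.2 ?_)
    rw [← (linearIndependent_monomialPoint n ζ).span_eq_top_of_card_eq_finrank (by simp),
      Submodule.span_le]
    rintro _ ⟨k, rfl⟩
    exact hall _ (monomialPoint_mem n ζ k)
  have htop : W 0 ⊔ Submodule.span ℝ {u} = ⊤ := by
    refine Submodule.eq_top_of_finrank_eq (le_antisymm (Submodule.finrank_le _) ?_)
    rw [Module.finrank_fin_fun]
    refine Nat.succ_le_of_lt ((hWrank 0).trans_lt (Submodule.finrank_lt_finrank_of_lt ?_))
    refine lt_of_le_of_ne le_sup_left fun heq => hi ?_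
    rw [heq]
    exact Submodule.mem_sup_right (Submodule.mem_span_singleton_self u)
  obtain ⟨w, hw, _, hx, hew⟩ := Submodule.mem_sup.1 (htop ▸ Submodule.mem_top : e ∈ _)
  obtain ⟨t, rfl⟩ := Submodule.mem_span_singleton.1 hx
  obtain ⟨k, hk⟩ : ∃ k, |t| * q k ^ (-(1 / (n : ℝ))) ≤ 1 := by
    have h1 : Tendsto q atTop atTop :=
      (tendsto_pow_atTop_atTop_of_one_lt one_lt_two).const_mul_atTop (by linarith)
    have h2 := ((tendsto_rpow_neg_atTop (y := 1 / (n : ℝ)) (by positivity)).comp h1).const_mul |t|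
    rw [mul_zero] at h2
    exact ((h2.eventually_le_const one_pos)).exists
  have hqk : 0 < q k := by linarith [hq k]
  rw [← hconst k] at hw heW
  obtain ⟨γ, hγ, hγW, hdist⟩ := exists_near_of_mem_span_smallPoints hqk hw
  refine heW ((Submodule.sub_mem_iff_left _ hγW).1 ?_)
  change e - γ ∈ W k
  rw [hWV]
  refine Submodule.subset_span ⟨(dualLatticeSubgroup n ζ).sub_mem he hγ, ?_⟩
  have h1 : e - γ = (w - γ) + t • u := by rw [← hew]; abel
  rw [h1]
  refine (qNorm_add_le n hqk _ _).trans ?_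
  rw [qNorm_smul, qNorm_single_succ]
  have h2 : Module.finrank ℝ (W k) * (q k ^ a / C) ≤ q k ^ a / 2 := by
    have h3 : (Module.finrank ℝ (W k) : ℝ) ≤ n := by
      rw [hWV]; exact_mod_cast hVrank k
    have h4 : 0 < q k ^ a := by linarith [ha _ (hq k)]
    calc Module.finrank ℝ (W k) * (q k ^ a / C) ≤ n * (q k ^ a / C) := by gcongr
      _ = (2 * n) * (q k ^ a / (2 * C)) := by field_simp
      _ ≤ C * (q k ^ a / (2 * C)) := by gcongr
      _ = q k ^ a / 2 := by field_simp
  have h5 := hdist.trans h2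
  linarith [ha _ (hq k)]

/-! ### Lower limits of the exponents -/

theorem span_smallPoints_ne_top {n : ℕ} {ζ Q B : ℝ} (hQ : 0 < Q) (hB : 0 < B)
    (h : B < dualLambda n ζ (n + 1) Q) : Submodule.span ℝ (smallPoints n ζ Q B) ≠ ⊤ := by
  intro htop
  obtain ⟨f, hf, -, hli⟩ := Submodule.exists_fun_fin_finrank_span_eq ℝ (smallPoints n ζ Q B)
  have hd : Module.finrank ℝ (Submodule.span ℝ (smallPoints n ζ Q B)) = n + 1 := by
    rw [htop, finrank_top, Module.finrank_fin_fun]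
  exact h.not_ge (dualLambda_le hQ hB (f ∘ Fin.cast hd.symm)
    (hli.comp _ (Fin.cast_injective hd.symm)) fun i => hf _)

/-- If `a` is a lower bound for `ψ*_{n,n+1}` at all large `Q`, then `λ*_{n,1}(Q)` is at most a
constant multiple of `Q^(-2a/(n-1))` for arbitrarily large `Q`. -/
theorem exists_frequently_dualLambda_one_le {n : ℕ} (hn : 2 ≤ n) {ζ : ℝ}
    (hζ : ¬ (IsAlgebraic ℚ ζ ∧ (minpoly ℚ ζ).natDegree ≤ n)) {a : ℝ} (ha : 0 < a)
    (h : ∀ᶠ Q in atTop, a < dualPsi n ζ (n + 1) Q) :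
    ∃ D : ℝ, ∃ᶠ Q in atTop,
      dualLambda n ζ 1 Q ≤ D * Q ^ (-(2 / ((n : ℝ) - 1)) * a) := by
  have hM := two_le_monomialBound n ζ
  -- the first two summands are needed for the loss of dimension, the third makes `Q ^ a / C ≤ Q`
  set C : ℝ := 2 * 2 ^ a + 2 * n + monomialBound n ζ with hC
  have hpa : 0 < (2 : ℝ) ^ a := by positivity
  have hn0 : (0 : ℝ) ≤ n := Nat.cast_nonneg _
  have hC0 : 0 < C := by linarith
  set s : ℝ := -(2 / ((n : ℝ) - 1)) with hs
  refine ⟨8 * (n + 1) ^ 2 * (C * (n + 1)) ^ (-s), ?_⟩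
  rw [frequently_atTop]
  intro Q₁
  have hlarge := (tendsto_rpow_atTop ha).eventually_ge_atTop (5 * (C * (n + 1)) + 2)
  obtain ⟨Q₂, hQ₂⟩ := eventually_atTop.1 (h.and hlarge)
  set Q₀ := max (max Q₁ Q₂) 2 with hQ₀
  have hQ₀2 : 2 ≤ Q₀ := le_max_right _ _
  have hall : ∀ Q, Q₀ ≤ Q → a < dualPsi n ζ (n + 1) Q ∧ 5 * (C * (n + 1)) + 2 ≤ Q ^ a :=
    fun Q hQ => hQ₂ Q (((le_max_right _ _).trans (le_max_left _ _)).trans hQ)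
  have hlam : ∀ Q, Q₀ ≤ Q → Q ^ a < dualLambda n ζ (n + 1) Q := fun Q hQ => by
    have h1 : 1 < Q := by linarith
    exact (Real.lt_logb_iff_rpow_lt h1 ((Real.rpow_pos_of_pos (by linarith) _).trans_le
      (le_dualLambda h1.le (by omega) le_rfl))).1 (hall Q hQ).1
  have hCn : 0 < C * (n + 1) := by positivity
  obtain ⟨Q, hQ, hfin⟩ := exists_finrank_span_smallPoints_le hn hζ (a := a) (C := C) (Q₀ := Q₀)
    (by linarith) (by linarith) (by linarith) (fun Q hQ => by linarith [(hall Q hQ).2])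
    (fun Q hQ => span_smallPoints_ne_top (by linarith)
      (Real.rpow_pos_of_pos (by linarith) _) (hlam Q hQ))
  refine ⟨Q, ((le_max_left _ _).trans (le_max_left _ _)).trans hQ, ?_⟩
  have hQ0 : 0 < Q := by linarith
  have hQa : 0 < Q ^ a := Real.rpow_pos_of_pos hQ0 _
  have e : (n + 1) * (Q ^ a / (C * (n + 1))) = Q ^ a / C := by field_simp
  have hB5 : 5 ≤ Q ^ a / (C * (n + 1)) := by
    rw [le_div_iff₀ hCn]; linarith [(hall Q hQ).2]
  have hBQ : Q ^ a / (C * (n + 1)) ≤ Q := by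
    -- the monomial points show that `λ*_{n,n+1}(Q) ≤ C Q`
    have h1 := (hlam Q hQ).le.trans (dualLambda_le_monomialBound (by linarith) le_rfl)
    rw [div_le_iff₀ hCn]
    refine h1.trans ?_
    rw [mul_comm]
    refine mul_le_mul_of_nonneg_left ?_ hQ0.le
    have h2 : C ≤ C * (n + 1) := le_mul_of_one_le_right hC0.le (by linarith)
    linarith
  refine (dualLambda_one_le_rpow hn hB5 hBQ (by rwa [e])).trans_eq ?_
  rw [← hs, Real.div_rpow hQa.le hCn.le, ← Real.rpow_mul hQ0.le, Real.rpow_neg hCn.le s,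
    mul_comm a s]
  ring

/-- A constant factor does not influence the lower limit of the exponent. -/
theorem liminf_dualPsi_one_le_of_frequently {n : ℕ} {ζ D t : ℝ}
    (h : ∃ᶠ Q in atTop, dualLambda n ζ 1 Q ≤ D * Q ^ t) :
    liminf (dualPsi n ζ 1) atTop ≤ t := by
  refine le_of_forall_pos_le_add fun ε hε => ?_
  refine liminf_le_of_frequently_le ?_ (isBoundedUnder_ge_dualPsi ζ le_rfl (by omega))
  refine (h.and_eventually (((tendsto_rpow_atTop hε).eventually_ge_atTop D).and
    (eventually_gt_atTop 1))).mono ?_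
  rintro Q ⟨h1, h2, hQ⟩
  have hQ0 : 0 < Q := by linarith
  refine dualPsi_le_of_dualLambda_le hQ le_rfl (by omega) (h1.trans ?_)
  rw [Real.rpow_add hQ0, mul_comm]
  exact mul_le_mul_of_nonneg_left h2 (Real.rpow_nonneg hQ0.le _)

theorem mainTheorem4 (n : ℕ) (hn : 2 ≤ n) (ζ : ℝ)
    (hζ : ¬ (IsAlgebraic ℚ ζ ∧ (minpoly ℚ ζ).natDegree ≤ n)) :
    -- the parametric functions are bounded for large `Q`, so both lower limits are real numbers
    (∀ j : ℕ, 1 ≤ j → j ≤ n + 1 →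
      IsBoundedUnder (· ≤ ·) atTop (dualPsi n ζ j) ∧
      IsBoundedUnder (· ≥ ·) atTop (dualPsi n ζ j)) ∧
    liminf (dualPsi n ζ 1) atTop ≤
      -(2 / ((n : ℝ) - 1)) * liminf (dualPsi n ζ (n + 1)) atTop := by
  refine ⟨fun j hj1 hj => ⟨isBoundedUnder_le_dualPsi ζ hj1 hj,
    isBoundedUnder_ge_dualPsi ζ hj1 hj⟩, ?_⟩
  have hn1 : (0 : ℝ) < (n : ℝ) - 1 := by
    have : (2 : ℝ) ≤ n := by exact_mod_cast hn
    linarith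
  have hs : 0 < 2 / ((n : ℝ) - 1) := by positivity
  rcases le_or_gt (liminf (dualPsi n ζ (n + 1)) atTop) 0 with ha | ha
  · refine le_trans ?_ (mul_nonneg_of_nonpos_of_nonpos (neg_nonpos.2 hs.le) ha)
    refine liminf_dualPsi_one_le_of_frequently
      (D := (n + 1) * 2 + (n + 1) * 2) ?_
    refine ((eventually_ge_atTop 2).mono fun Q hQ => ?_).frequently
    rw [Real.rpow_zero, mul_one]
    exact dualLambda_one_le_const (by omega) ζ hQ
  · have key : ∀ a, 0 < a → a < liminf (dualPsi n ζ (n + 1)) atTop →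
        liminf (dualPsi n ζ 1) atTop ≤ -(2 / ((n : ℝ) - 1)) * a := fun a ha0 hlt => by
      obtain ⟨D, h⟩ := exists_frequently_dualLambda_one_le hn hζ ha0
        (eventually_lt_of_lt_liminf hlt (isBoundedUnder_ge_dualPsi ζ (by omega) le_rfl))
      exact liminf_dualPsi_one_le_of_frequently h
    -- let `a` increase to the lower limit of `ψ*_{n,n+1}`
    have hle : liminf (dualPsi n ζ (n + 1)) atTop ≤
        -liminf (dualPsi n ζ 1) atTop / (2 / ((n : ℝ) - 1)) := by
      refine le_of_forall_lt_imp_le_of_dense fun a hlt => ?_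
      rcases lt_or_ge 0 a with ha0 | ha0
      · rw [le_div_iff₀ hs]
        linarith [key a ha0 hlt]
      · have h1 := key _ (half_pos ha) (half_lt_self ha)
        refine ha0.trans (div_nonneg ?_ hs.le)
        have := mul_pos hs (half_pos ha)
        linarith
    rw [le_div_iff₀ hs] at hle
    linarith
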